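/- Consider partitions whose parts are positive integers coloured with one of the three colours $1,2,3$ (the order among equal parts of different colours being immaterial), in which all parts of colour $1$ or $3$ are even and all parts of colour $2$ are odd. For such a coloured partition $\lambda$ let $f_i^{(c)}$ be the number of parts of size $i$ and colour $c$, let $l(\lambda)$ be the number of parts and $|\lambda|$ the sum of all parts. Given nonnegative integers $k_0,k_1,k_2$, put $f_0^{(1)}:=k_0$, $f_{-1}^{(2)}:=k_1$, $f_0^{(3)}:=k_2$, and let $\mathscr{D}_{k_0,k_1,k_2}$ be the set of those $\lambda$ for which \[ f_{i_1}^{(1)}+f_{i_2}^{(2)}+f_{i_3}^{(3)}\leq k_0+k_1+k_2 \] for all integers $i_1,i_3\geq 0$ even and $i_2\geq -1$ odd such that $|i_1-i_2|=|i_2-i_3|=1$. Define the formal power series \[ \mathcal{D}^{(2)}_{k_0\Lambda_0+k_1\Lambda_1+k_2\Lambda_2}(z,q):=\sum_{\lambda\in\mathscr{D}_{k_0,k_1,k_2}} z^{l(\lambda)}q^{|\lambda|}. \] For $d\ge 1$ and $m\in\mathbb{Z}$ let $(q^d;q^d)_m:=\prod_{j=1}^m(1-q^{dj})$ if $m\geq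 0$, and $1/(q^d;q^d)_m:=0$ if $m<0$. **Theorem.** As formal power series in $z$ and $q$, \begin{align*} \mathcal{D}^{(2)}_{2\Lambda_0}(z,q)&= \sum_{r_1,r_2,s_1,s_2\geq 0}\, \prod_{i=1}^2 \frac{z^{r_i+s_i}q^{(r_i+s_i)^2+s_i^2+r_i+2s_i}} {(q;q)_{r_i-r_{i+1}}(q^2;q^2)_{s_i-s_{i-1}}}, \\ \mathcal{D}^{(2)}_{2\Lambda_1}(z,q)&= \sum_{r_1,r_2,s_1,s_2\geq 0}\, \prod_{i=1}^2 \frac{z^{r_i+s_i} q^{(r_i+s_i)^2+s_i^2}} {(q;q)_{r_i-r_{i+1}}(q^2;q^2)_{s_i-s_{i-1}}}, \\ \mathcal{D}^{(2)}_{\Lambda_0+\Lambda_1}(z,q)&= \sum_{r_1,r_2,s_1,s_2\geq 0}\, \bigg(\prod_{i=1}^2 \frac{z^{r_i+s_i} q^{(r_i+s_i)^2+s_i^2+\delta_{i,2}(r_i+2s_i)}} {(q;q)_{r_i-r_{i+1}}(q^2;q^2)_{s_i-s_{i-1}}}\bigg) \Big(1+zq^{2+r_1+r_2+2s_1+2s_2}\Big),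 \\ \mathcal{D}^{(2)}_{\Lambda_0+\Lambda_2}(z,q)&= \sum_{r_1,r_2,s_1,s_2\geq 0}\, \bigg(\prod_{i=1}^2 \frac{z^{r_i+s_i} q^{(r_i+s_i)^2+s_i^2+r_i+2\delta_{i,2}s_i}} {(q;q)_{r_i-r_{i+1}}(q^2;q^2)_{s_i-s_{i-1}}}\bigg) \Big(1+zq^{2+r_1+r_2+2s_1+2s_2}\Big), \end{align*} where $r_3=s_0:=0$ and $\delta_{i,j}$ is the Kronecker delta. -/

import Mathlib

open scoped PowerSeries PowerSeries.WithPiTopology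

/-- A partition whose parts carry one of `m` colours: `freq (c, i)` is the number of parts of
size `i` and colour `c`. The colours `0, …, m - 1` stand for the colour labels `1, …, m`; there are
only finitely many parts, and all of them are positive. -/
@[ext]
structure ColouredPartition (m : ℕ) where
  freq : Fin m × ℕ →₀ ℕ
  freq_zero : ∀ c, freq (c, 0) = 0

namespace ColouredPartition

/-- The number `l(λ)` of parts. -/
def length {m : ℕ} (p : ColouredPartition m) : ℕ := p.freq.sum fun _ f => f

/-- The sum `|λ|` of all parts. -/
def size {m : ℕ} (p : ColouredPartition m) : ℕ := p.freq.sum fun a f => a.2 * f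

end ColouredPartition

/-- The entry `f_i^{(c+1)}` (`i ≥ -1`) of the frequency array, including the boundary entries
`f_{-1}^{(2j)} = k_j` for `1 ≤ j ≤ n - 1` and
`f_0^{(2j-1)} = k_0 δ_{j,1} + k_n δ_{j,n}` for `1 ≤ j ≤ n`.
Only the entries for which `i` plus the colour label is odd belong to the array. -/
def arrayEntry {n : ℕ} (k : Fin (n + 1) → ℕ) (p : ColouredPartition (2 * n - 1))
    (c : Fin (2 * n - 1)) (i : ℤ) : ℕ :=
  if i = -1 then k (Fin.ofNat (n + 1) ((c.val + 1) / 2))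
  else if i = 0 then
    (if c.val = 0 then k 0 else 0) + (if c.val + 1 = 2 * n - 1 then k (Fin.last n) else 0)
  else p.freq (c, i.toNat)

/-- The index sequences `(i_1, …, i_{2n-1})` of the paths on the frequency array: one column index
per row, lying in the array, with consecutive indices differing by `1`. -/
structure IsPath {n : ℕ} (i : Fin (2 * n - 1) → ℤ) : Prop where
  neg_one_le : ∀ c, -1 ≤ i c
  odd : ∀ c, Odd (i c + ((c.val : ℤ) + 1))
  step : ∀ c d : Fin (2 * n - 1), c.val + 1 = d.val → |i c - i d| = 1

/-- The set `𝒟_{k_0, …, k_n}` (`n ≥ 1`) of admissible partitions in `2n - 1` colours: parts with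
an even (odd) colour label are odd (even), and along every path of the frequency array the entries
add up to at most `k_0 + ⋯ + k_n`. -/
def dPartitions (n : ℕ) (k : Fin (n + 1) → ℕ) : Set (ColouredPartition (2 * n - 1)) :=
  {p | (∀ c i, p.freq (c, i) ≠ 0 → Odd (i + (c.val + 1))) ∧
    ∀ i : Fin (2 * n - 1) → ℤ, IsPath i → ∑ c, arrayEntry k p c (i c) ≤ ∑ j, k j}

/-- The generating function `∑_{λ ∈ 𝒟_{k_0, …, k_n}} z^{l(λ)} q^{|λ|}`, as a power series in `z`
whose coefficients are power series in `q`. -/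
noncomputable def dGenFun (n : ℕ) (k : Fin (n + 1) → ℕ) : ℤ⟦X⟧⟦X⟧ :=
  PowerSeries.mk fun l => PowerSeries.mk fun N =>
    (({p ∈ dPartitions n k | p.length = l ∧ p.size = N}.ncard : ℕ) : ℤ)

/-- The variable `z`. -/
noncomputable def zVar : ℤ⟦X⟧⟦X⟧ := PowerSeries.X

/-- The variable `q`. -/
noncomputable def qVar : ℤ⟦X⟧⟦X⟧ := PowerSeries.C PowerSeries.X

/-- `(q^d; q^d)_m = (1 - q^d) (1 - q^{2d}) ⋯ (1 - q^{md})`. -/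
noncomputable def qPoch (d m : ℕ) : ℤ⟦X⟧ :=
  ∏ j ∈ Finset.range m, (1 - PowerSeries.X ^ (d * (j + 1)))

/-- `1 / (q^d; q^d)_m` for an integer `m`, which vanishes for `m < 0`. -/
noncomputable def invQPoch (d : ℕ) (m : ℤ) : ℤ⟦X⟧ :=
  if m < 0 then 0 else PowerSeries.invOfUnit (qPoch d m.toNat) 1

/-- The factor `z^{r+s} q^{(r+s)^2+s^2+e} / ((q;q)_{a} (q^2;q^2)_{b})` of the multisums. -/
noncomputable def multisumFactor (r s e : ℕ) (a b : ℤ) : ℤ⟦X⟧⟦X⟧ :=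
  zVar ^ (r + s) * qVar ^ ((r + s) ^ 2 + s ^ 2 + e) *
    PowerSeries.C (invQPoch 1 a) * PowerSeries.C (invQPoch 2 b)

theorem qPoch_mul_invQPoch {d : ℕ} (hd : 0 < d) (m : ℕ) :
    qPoch d m * invQPoch d m = 1 := by
  have h : ¬ ((m : ℤ) < 0) := by omega
  rw [invQPoch, if_neg h, Int.toNat_natCast]
  refine PowerSeries.mul_invOfUnit _ _ ?_
  simp only [qPoch, map_prod, map_sub, map_one, map_pow, PowerSeries.constantCoeff_X, Units.val_one]
  refine Finset.prod_eq_one fun j _ => ?_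
  rw [zero_pow (by positivity), sub_zero]

/-- The sets counted in the generating function are finite. -/
theorem finite_size_eq (m N : ℕ) : {p : ColouredPartition m | p.size = N}.Finite := by
  have hle : ∀ p : ColouredPartition m, p.size = N → ∀ a : Fin m × ℕ, a.2 * p.freq a ≤ N := by
    intro p hp a
    by_cases ha : p.freq a = 0
    · simp [ha]
    · rw [← hp]
      exact Finset.single_le_sum (f := fun a => a.2 * p.freq a) (fun _ _ => Nat.zero_le _)
        (Finsupp.mem_support_iff.mpr ha)
  refine Set.Finite.of_injOn (t := (Set.univ : Set (Fin m × Fin (N + 1) → Fin (N + 1))))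
    (f := fun p a => Fin.ofNat (N + 1) (p.freq (a.1, a.2.val))) (fun _ _ => Set.mem_univ _)
    ?_ Set.finite_univ
  intro p hp p' hp' h
  have key : ∀ p : ColouredPartition m, p.size = N → ∀ c i, i ≠ 0 →
      p.freq (c, i) ≤ N ∧ (N < i → p.freq (c, i) = 0) := by
    intro p hp c i hi
    have h1 := hle p hp (c, i)
    simp only at h1
    refine ⟨le_trans (Nat.le_mul_of_pos_left _ (Nat.pos_of_ne_zero hi)) h1, fun hN => ?_⟩
    by_contra h0
    have := Nat.le_mul_of_pos_right i (Nat.pos_of_ne_zero h0)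
    omega
  apply ColouredPartition.ext
  ext ⟨c, i⟩
  rcases Nat.eq_zero_or_pos i with rfl | hi
  · rw [p.freq_zero, p'.freq_zero]
  · obtain ⟨h1, h2⟩ := key p hp c i hi.ne'
    obtain ⟨h3, h4⟩ := key p' hp' c i hi.ne'
    by_cases hN : N < i
    · rw [h2 hN, h4 hN]
    · have := congrArg Fin.val (congrFun h (c, ⟨i, by omega⟩))
      simp only [Fin.ofNat] at this
      rwa [Nat.mod_eq_of_lt (by omega), Nat.mod_eq_of_lt (by omega)] at this

/-- `dGenFun n k` is the sum of `z^{l(λ)} q^{|λ|}` over `𝒟_{k_0, …, k_n}`. -/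
theorem hasSum_dGenFun (n : ℕ) (k : Fin (n + 1) → ℕ) :
    HasSum (fun p : dPartitions n k => zVar ^ p.val.length * qVar ^ p.val.size) (dGenFun n k) := by
  classical
  rw [PowerSeries.WithPiTopology.hasSum_iff_hasSum_coeff]
  intro l
  rw [PowerSeries.WithPiTopology.hasSum_iff_hasSum_coeff]
  intro N
  have hfin : {p : dPartitions n k | p.val.length = l ∧ p.val.size = N}.Finite := by
    refine Set.Finite.of_injOn (f := Subtype.val) (fun p hp => hp.2)
      Subtype.val_injective.injOn (finite_size_eq (2 * n - 1) N)
  have hterm : ∀ p : dPartitions n k, PowerSeries.coeff N (PowerSeries.coeff l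
      (zVar ^ p.val.length * qVar ^ p.val.size)) =
      if p.val.length = l ∧ p.val.size = N then 1 else 0 := by
    intro p
    rw [zVar, qVar, ← map_pow, PowerSeries.coeff_mul_C, PowerSeries.coeff_X_pow]
    by_cases h : l = p.val.length
    · simp [h, PowerSeries.coeff_X_pow, eq_comm]
    · simp [h, Ne.symm h]
  have hcard : PowerSeries.coeff N (PowerSeries.coeff l (dGenFun n k)) =
      ∑ p ∈ hfin.toFinset, PowerSeries.coeff N (PowerSeries.coeff l
        (zVar ^ p.val.length * qVar ^ p.val.size)) := by
    rw [Finset.sum_congr rfl fun p hp => (hterm p).trans (if_pos (hfin.mem_toFinset.mp hp))]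
    rw [dGenFun, PowerSeries.coeff_mk, PowerSeries.coeff_mk, Finset.sum_const, nsmul_one,
      ← Set.ncard_eq_toFinset_card _ hfin,
      ← Set.ncard_image_of_injective _ Subtype.val_injective]
    congr 2
    ext p
    constructor
    · rintro ⟨h1, h2⟩
      exact ⟨⟨p, h1⟩, h2, rfl⟩
    · rintro ⟨p', h2, rfl⟩
      exact ⟨p'.2, h2⟩
  rw [hcard]
  refine hasSum_sum_of_ne_finset_zero fun p hp => ?_
  rw [hterm, if_neg]
  exact fun h => hp (hfin.mem_toFinset.mpr h)

/-! Both sides are shown to solve the same linear q-difference system, whose solution is determined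
by one constant term.

Combinatorial side: fix the level K = k₀ + k₁ + k₂ and let the boundary pair (k₀, k₂) vary. Remove
the parts 1 of colour 2 and the parts 2 of colours 1 and 3, then lower all other parts by 2. What is
left is admissible at the same level, and its boundary pair is given by the numbers of removed parts
2. Lowering by 2 is the substitution z ↦ zq², so the generating functions satisfy G_i(z) = ∑_j
T_ij(z) G_j(zq²) with a finite transfer matrix T (`levelGenFun_eq_sum`).

Analytic side: the quadruple sums with arbitrary linear exponents form a family closed under z ↦ zq²
(`rescale_quadSum`) and satisfy four contiguous relations (`isContiguous_quadSum`). For K = 2 the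
rows of the system are linear combinations of these relations (`levelTwoSum_eq_sum`).

Uniqueness (`eq_of_eq_sum_rescale`): at z = 0 only the column of the pair (0, 0) in T survives,
which allows induction on the degree in z. -/

/-! ### Contiguous relations and the level 2 identities they imply. -/

/-- The contiguous relations of the quadruple sums
`∑ z^{r₁+r₂+s₁+s₂} q^{(r₁+s₁)²+s₁²+(r₂+s₂)²+s₂²+a₁r₁+a₂r₂+b₁s₁+b₂s₂} /
  ((q;q)_{r₁-r₂} (q;q)_{r₂} (q²;q²)_{s₁} (q²;q²)_{s₂-s₁})`. -/
structure IsContiguous {R : Type*} [CommRing R] (z q : R) (F : ℕ → ℕ → ℕ → ℕ → R) : Prop where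
  r₁_sub_r₂ : ∀ a₁ a₂ b₁ b₂, F a₁ (a₂ + 1) b₁ b₂ - F (a₁ + 1) a₂ b₁ b₂ =
    z * q ^ (1 + a₁) * F (a₁ + 2) (a₂ + 1) (b₁ + 2) b₂
  r₂ : ∀ a₁ a₂ b₁ b₂, F a₁ a₂ b₁ b₂ - F a₁ (a₂ + 1) b₁ b₂ =
    z ^ 2 * q ^ (2 + a₁ + a₂) * F (a₁ + 2) (a₂ + 2) (b₁ + 2) (b₂ + 2)
  s₁ : ∀ a₁ a₂ b₁ b₂, F a₁ a₂ b₁ b₂ - F a₁ a₂ (b₁ + 2) b₂ =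
    z ^ 2 * q ^ (4 + b₁ + b₂) * F (a₁ + 2) (a₂ + 2) (b₁ + 4) (b₂ + 4)
  s₂_sub_s₁ : ∀ a₁ a₂ b₁ b₂, F a₁ a₂ (b₁ + 2) b₂ - F a₁ a₂ b₁ (b₂ + 2) =
    z * q ^ (2 + b₂) * F a₁ (a₂ + 2) (b₁ + 2) (b₂ + 4)

namespace IsContiguous

variable {R : Type*} [CommRing R] {z q : R} {F : ℕ → ℕ → ℕ → ℕ → R}

/-- This identity and the next three are the rows of the level 2 transfer system, named after the
boundary pair. Raising all four arguments of F by 2 plays the role of z ↦ zq². The proofs are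
explicit certificates in the span of the contiguous relations, so no convergence is involved. -/
theorem eq_one_zero (h : IsContiguous z q F) :
    F 0 1 0 2 + z * q ^ 2 * F 1 2 2 4 = (1 + z * q) * F 2 2 2 2 + (2 + z * q) * (z * q ^ 2)
      * (F 2 3 2 4 + z * q ^ 4 * F 3 4 4 6) + (z * q ^ 2) ^ 2 * F 3 3 4 4 + (z * q ^ 2) ^ 2
      * (F 3 3 2 4 + z * q ^ 4 * F 4 4 4 6) := by
  obtain ⟨h1, h2, h3, h4⟩ := h
  linear_combination (norm := skip) z * q ^ 2 * h2 2 2 2 4 + h2 0 1 0 2 + z * q ^ 2 * h2 1 2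
    2 4 + z * q ^ 2 * h1 1 2 2 4 + h2 1 1 0 2 + h1 0 1 0 2 + h2 1 2 2 2 + z ^ 2 * q ^ 5 * h1
    3 3 4 4 - z * q ^ 2 * h2 3 2 4 2 + h1 1 2 2 2 + z * q ^ 2 * h4 3 2 2 2 - z * q ^ 2 * h1
    2 2 2 4 + h3 1 2 0 2
  simp only [Nat.reduceAdd]
  ring

theorem eq_two_zero (h : IsContiguous z q F) :
    F 1 1 2 2 = F 2 2 2 2 + z * q ^ 2 * (F 2 3 2 4 + z * q ^ 4 * F 3 4 4 6) + (z * q ^ 2) ^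
      2 * F 3 3 4 4 := by
  obtain ⟨h1, h2, h3, h4⟩ := h
  linear_combination (norm := skip) z * q ^ 2 * h4 3 2 2 2 + h1 1 1 2 2 + h2 1 1 2 2 + h2 2
    1 2 2 - z * q ^ 2 * h1 2 2 2 4
  simp only [Nat.reduceAdd]
  ring

theorem eq_one_one (h : IsContiguous z q F) :
    F 1 1 0 2 + z * q ^ 2 * F 2 2 2 4 = F 2 2 2 2 + 2 * (z * q ^ 2) * (F 2 3 2 4 + z * q ^ 4
      * F 3 4 4 6) + (z * q ^ 2) ^ 2 * (F 3 3 2 4 + z * q ^ 4 * F 4 4 4 6) := by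
  obtain ⟨h1, h2, h3, h4⟩ := h
  linear_combination (norm := skip) z * q ^ 2 * h2 2 2 2 4 + h2 1 1 0 2 + h3 1 2 0 2 - z * q
    ^ 2 * h2 3 2 4 2 + z ^ 2 * q ^ 5 * h1 3 3 4 4 - z * q ^ 2 * h1 2 2 2 4 + h2 1 2 2 2 + h1
    1 2 2 2 + z * q ^ 2 * h4 3 2 2 2
  simp only [Nat.reduceAdd]
  ring

theorem eq_zero_zero (h : IsContiguous z q F) :
    F 0 0 0 0 = (1 + z * q + (z * q) ^ 2) * F 2 2 2 2 + 2 * (1 + z * q) * (z * q ^ 2) * (F 2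
      3 2 4 + z * q ^ 4 * F 3 4 4 6) + 2 * (z * q ^ 2) ^ 2 * F 3 3 4 4 + (z * q ^ 2) ^ 2 *
      (F 3 3 2 4 + z * q ^ 4 * F 4 4 4 6) := by
  -- The row of the pair (1, 0) is subtracted; the contiguous relations only have to account for the
  -- difference of the two rows.
  have hB := h.eq_one_zero
  obtain ⟨h1, h2, h3, h4⟩ := h
  linear_combination (norm := skip) hB + z * q * h3 1 2 0 2 + h3 1 1 0 0 + z * q * h4 2 1 0
    0 + h1 0 0 0 0 - z * q * h1 1 1 0 2 + h2 1 0 0 0 + h2 0 0 0 0 + h4 1 0 0 0 - h1 0 0 0 2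
    - h2 1 0 2 0 + z * q * h1 1 1 2 2
  simp only [Nat.reduceAdd]
  ring

end IsContiguous

/-! ### The quadruple sums and their contiguous relations. -/

theorem invQPoch_of_neg {d : ℕ} {m : ℤ} (hm : m < 0) : invQPoch d m = 0 := if_pos hm

/-- Source of all contiguous relations. For m = 0 both sides vanish, the left one through 1 - q⁰ and
the right one by the convention for negative indices. -/
theorem invQPoch_mul_one_sub {d : ℕ} (hd : 0 < d) (m : ℕ) :
    invQPoch d m * (1 - PowerSeries.X ^ (d * m)) = invQPoch d ((m : ℤ) - 1) := by
  cases m with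
  | zero => simp [invQPoch_of_neg]
  | succ m =>
    have h1 := qPoch_mul_invQPoch hd (m + 1)
    have h2 := qPoch_mul_invQPoch hd m
    rw [qPoch, Finset.prod_range_succ, ← qPoch] at h1
    rw [show ((m + 1 : ℕ) : ℤ) - 1 = (m : ℤ) by push_cast; ring]
    calc _ = (qPoch d m * invQPoch d m) *
          (invQPoch d ((m + 1 : ℕ) : ℤ) * (1 - PowerSeries.X ^ (d * (m + 1)))) := by
          rw [h2, one_mul]
      _ = (qPoch d m * (1 - PowerSeries.X ^ (d * (m + 1))) * invQPoch d ((m + 1 : ℕ) : ℤ)) *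
          invQPoch d m := by ring
      _ = _ := by rw [h1, one_mul]

/-- The coefficient of the power of `z` in the summand of the quadruple sum with linear exponents
`a₁ r₁ + a₂ r₂ + b₁ s₁ + b₂ s₂`. -/
noncomputable def quadCoeff (a₁ a₂ b₁ b₂ r₁ r₂ s₁ s₂ : ℕ) : ℤ⟦X⟧ :=
  PowerSeries.X ^ ((r₁ + s₁) ^ 2 + s₁ ^ 2 + ((r₂ + s₂) ^ 2 + s₂ ^ 2) +
      (a₁ * r₁ + a₂ * r₂ + b₁ * s₁ + b₂ * s₂)) *
    (invQPoch 1 ((r₁ : ℤ) - r₂) * invQPoch 1 r₂ * invQPoch 2 s₁ * invQPoch 2 ((s₂ : ℤ) - s₁))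

/-- The summand of the quadruple sum. -/
noncomputable def quadTerm (a₁ a₂ b₁ b₂ : ℕ) (x : ℕ × ℕ × ℕ × ℕ) : ℤ⟦X⟧⟦X⟧ :=
  zVar ^ (x.1 + x.2.1 + x.2.2.1 + x.2.2.2) *
    PowerSeries.C (quadCoeff a₁ a₂ b₁ b₂ x.1 x.2.1 x.2.2.1 x.2.2.2)

theorem multisumFactor_mul (r₁ r₂ s₁ s₂ e₁ e₂ a₁ a₂ b₁ b₂ : ℕ)
    (he : e₁ + e₂ = a₁ * r₁ + a₂ * r₂ + b₁ * s₁ + b₂ * s₂) :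
    multisumFactor r₁ s₁ e₁ ((r₁ : ℤ) - r₂) ((s₁ : ℤ) - 0) *
      multisumFactor r₂ s₂ e₂ ((r₂ : ℤ) - 0) ((s₂ : ℤ) - s₁) =
    quadTerm a₁ a₂ b₁ b₂ (r₁, r₂, s₁, s₂) := by
  rw [quadTerm, quadCoeff, multisumFactor, multisumFactor, ← he, sub_zero, sub_zero, qVar]
  simp only [map_mul, map_pow]
  ring

/-- The quadruple sum. -/
noncomputable def quadSum (a₁ a₂ b₁ b₂ : ℕ) : ℤ⟦X⟧⟦X⟧ :=
  ∑' x, quadTerm a₁ a₂ b₁ b₂ x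

theorem coeff_quadTerm (l a₁ a₂ b₁ b₂ : ℕ) (x : ℕ × ℕ × ℕ × ℕ) :
    PowerSeries.coeff l (quadTerm a₁ a₂ b₁ b₂ x) =
      if l = x.1 + x.2.1 + x.2.2.1 + x.2.2.2 then
        quadCoeff a₁ a₂ b₁ b₂ x.1 x.2.1 x.2.2.1 x.2.2.2 else 0 := by
  rw [quadTerm, zVar, PowerSeries.coeff_mul_C, PowerSeries.coeff_X_pow, ite_mul, one_mul, zero_mul]

theorem hasSum_quadSum (a₁ a₂ b₁ b₂ : ℕ) :
    HasSum (quadTerm a₁ a₂ b₁ b₂) (quadSum a₁ a₂ b₁ b₂) := by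
  refine Summable.hasSum ?_
  rw [PowerSeries.WithPiTopology.summable_iff_summable_coeff]
  intro l
  -- The exponent of z is r₁ + r₂ + s₁ + s₂, so each coefficient in z receives only finitely many
  -- terms.
  refine summable_of_ne_finset_zero (s := Finset.range (l + 1) ×ˢ Finset.range (l + 1) ×ˢ
    Finset.range (l + 1) ×ˢ Finset.range (l + 1)) fun x hx => ?_
  rw [coeff_quadTerm, if_neg]
  rintro rfl
  apply hx
  simp only [Finset.mem_product, Finset.mem_range]
  omega

/-- The substitution z ↦ zq² multiplies a summand by q^{2(r₁+r₂+s₁+s₂)}, which is absorbed in the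
linear exponents. -/
theorem rescale_quadSum (a₁ a₂ b₁ b₂ : ℕ) :
    PowerSeries.rescale (PowerSeries.X ^ 2) (quadSum a₁ a₂ b₁ b₂) =
      quadSum (a₁ + 2) (a₂ + 2) (b₁ + 2) (b₂ + 2) := by
  refine HasSum.unique ?_ (hasSum_quadSum _ _ _ _)
  have h := hasSum_quadSum a₁ a₂ b₁ b₂
  rw [PowerSeries.WithPiTopology.hasSum_iff_hasSum_coeff] at h ⊢
  intro l
  rw [PowerSeries.coeff_rescale]
  refine ((h l).mul_left _).congr_fun fun x => ?_
  rw [coeff_quadTerm, coeff_quadTerm]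
  split_ifs with hl
  · rw [hl, quadCoeff, quadCoeff, ← pow_mul]
    ring
  · rw [mul_zero]

theorem constantCoeff_quadSum (a₁ a₂ b₁ b₂ : ℕ) :
    PowerSeries.constantCoeff (quadSum a₁ a₂ b₁ b₂) = 1 := by
  have h := hasSum_quadSum a₁ a₂ b₁ b₂
  rw [PowerSeries.WithPiTopology.hasSum_iff_hasSum_coeff] at h
  rw [← PowerSeries.coeff_zero_eq_constantCoeff_apply]
  refine (h 0).unique ?_
  convert hasSum_single (0, 0, 0, 0) fun x hx => ?_
  · rw [coeff_quadTerm]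
    have h1 : invQPoch 1 0 = 1 := by simpa [qPoch] using qPoch_mul_invQPoch one_pos 0
    have h2 : invQPoch 2 0 = 1 := by simpa [qPoch] using qPoch_mul_invQPoch two_pos 0
    simp [quadCoeff, h1, h2]
  · rw [coeff_quadTerm, if_neg]
    rintro h0
    apply hx
    ext <;> dsimp only <;> omega

/-- Termwise form of a contiguous relation: g is an index shift, and the two summands agree wherever
the shift cannot be undone. -/
theorem quadSum_sub_eq {a₁ a₂ b₁ b₂ a₁' a₂' b₁' b₂' a₁'' a₂'' b₁'' b₂'' : ℕ} (i j : ℕ)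
    {g : ℕ × ℕ × ℕ × ℕ → ℕ × ℕ × ℕ × ℕ} (hg : Function.Injective g)
    (h0 : ∀ x ∉ Set.range g, quadTerm a₁ a₂ b₁ b₂ x = quadTerm a₁' a₂' b₁' b₂' x)
    (h1 : ∀ x, quadTerm a₁ a₂ b₁ b₂ (g x) - quadTerm a₁' a₂' b₁' b₂' (g x) =
      zVar ^ i * qVar ^ j * quadTerm a₁'' a₂'' b₁'' b₂'' x) :
    quadSum a₁ a₂ b₁ b₂ - quadSum a₁' a₂' b₁' b₂' =
      zVar ^ i * qVar ^ j * quadSum a₁'' a₂'' b₁'' b₂'' := by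
  have hs := (hasSum_quadSum a₁ a₂ b₁ b₂).sub (hasSum_quadSum a₁' a₂' b₁' b₂')
  refine ((hg.hasSum_iff fun x hx => sub_eq_zero.2 (h0 x hx)).2 hs).unique ?_
  exact ((hasSum_quadSum a₁'' a₂'' b₁'' b₂'').mul_left _).congr_fun fun x => h1 x

/-- The difference of the two powers of q contains the factor 1 - q^{r₁-r₂}, which cancels the last
factor of (q;q)_{r₁-r₂}. The first index is written as r + m to keep r₁ - r₂ a natural number. The
next three lemmas treat the other denominators likewise. -/
theorem quadCoeff_sub_r₁_sub_r₂ (a₁ a₂ b₁ b₂ m r s₁ s₂ : ℕ) :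
    quadCoeff a₁ (a₂ + 1) b₁ b₂ (r + m) r s₁ s₂ - quadCoeff (a₁ + 1) a₂ b₁ b₂ (r + m) r s₁ s₂ =
    PowerSeries.X ^ (((r + m) + s₁) ^ 2 + s₁ ^ 2 + ((r + s₂) ^ 2 + s₂ ^ 2) +
      (a₁ * (r + m) + (a₂ + 1) * r + b₁ * s₁ + b₂ * s₂)) *
    (invQPoch 1 ((m : ℤ) - 1) * invQPoch 1 r * invQPoch 2 s₁ * invQPoch 2 ((s₂ : ℤ) - s₁)) := by
  rw [← invQPoch_mul_one_sub one_pos, quadCoeff, quadCoeff,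
    show ((r + m : ℕ) : ℤ) - r = m by push_cast; ring]
  ring

theorem quadCoeff_sub_r₂ (a₁ a₂ b₁ b₂ r₁ r₂ s₁ s₂ : ℕ) :
    quadCoeff a₁ a₂ b₁ b₂ r₁ r₂ s₁ s₂ - quadCoeff a₁ (a₂ + 1) b₁ b₂ r₁ r₂ s₁ s₂ =
    PowerSeries.X ^ ((r₁ + s₁) ^ 2 + s₁ ^ 2 + ((r₂ + s₂) ^ 2 + s₂ ^ 2) +
      (a₁ * r₁ + a₂ * r₂ + b₁ * s₁ + b₂ * s₂)) *
    (invQPoch 1 ((r₁ : ℤ) - r₂) * invQPoch 1 ((r₂ : ℤ) - 1) * invQPoch 2 s₁ *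
      invQPoch 2 ((s₂ : ℤ) - s₁)) := by
  rw [← invQPoch_mul_one_sub one_pos, quadCoeff, quadCoeff]
  ring

theorem quadCoeff_sub_s₁ (a₁ a₂ b₁ b₂ r₁ r₂ s₁ s₂ : ℕ) :
    quadCoeff a₁ a₂ b₁ b₂ r₁ r₂ s₁ s₂ - quadCoeff a₁ a₂ (b₁ + 2) b₂ r₁ r₂ s₁ s₂ =
    PowerSeries.X ^ ((r₁ + s₁) ^ 2 + s₁ ^ 2 + ((r₂ + s₂) ^ 2 + s₂ ^ 2) +
      (a₁ * r₁ + a₂ * r₂ + b₁ * s₁ + b₂ * s₂)) *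
    (invQPoch 1 ((r₁ : ℤ) - r₂) * invQPoch 1 r₂ * invQPoch 2 ((s₁ : ℤ) - 1) *
      invQPoch 2 ((s₂ : ℤ) - s₁)) := by
  rw [← invQPoch_mul_one_sub two_pos, quadCoeff, quadCoeff]
  ring

theorem quadCoeff_sub_s₂_sub_s₁ (a₁ a₂ b₁ b₂ r₁ r₂ s m : ℕ) :
    quadCoeff a₁ a₂ (b₁ + 2) b₂ r₁ r₂ s (s + m) - quadCoeff a₁ a₂ b₁ (b₂ + 2) r₁ r₂ s (s + m) =
    PowerSeries.X ^ ((r₁ + s) ^ 2 + s ^ 2 + ((r₂ + (s + m)) ^ 2 + (s + m) ^ 2) +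
      (a₁ * r₁ + a₂ * r₂ + (b₁ + 2) * s + b₂ * (s + m))) *
    (invQPoch 1 ((r₁ : ℤ) - r₂) * invQPoch 1 r₂ * invQPoch 2 s * invQPoch 2 ((m : ℤ) - 1)) := by
  rw [← invQPoch_mul_one_sub two_pos, quadCoeff, quadCoeff,
    show ((s + m : ℕ) : ℤ) - s = m by push_cast; ring]
  ring

theorem quadTerm_eq_zero {a₁ a₂ b₁ b₂ : ℕ} {x : ℕ × ℕ × ℕ × ℕ}
    (h : x.1 < x.2.1 ∨ x.2.2.2 < x.2.2.1) : quadTerm a₁ a₂ b₁ b₂ x = 0 := by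
  rw [quadTerm, quadCoeff]
  rcases h with h | h
  · rw [invQPoch_of_neg (d := 1) (m := (x.1 : ℤ) - x.2.1) (by omega)]; simp
  · rw [invQPoch_of_neg (d := 2) (m := (x.2.2.2 : ℤ) - x.2.2.1) (by omega)]; simp

theorem quadTerm_sub (a₁ a₂ b₁ b₂ a₁' a₂' b₁' b₂' : ℕ) (x : ℕ × ℕ × ℕ × ℕ) :
    quadTerm a₁ a₂ b₁ b₂ x - quadTerm a₁' a₂' b₁' b₂' x =
      zVar ^ (x.1 + x.2.1 + x.2.2.1 + x.2.2.2) *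
      PowerSeries.C (quadCoeff a₁ a₂ b₁ b₂ x.1 x.2.1 x.2.2.1 x.2.2.2 -
        quadCoeff a₁' a₂' b₁' b₂' x.1 x.2.1 x.2.2.1 x.2.2.2) := by
  rw [quadTerm, quadTerm, map_sub, mul_sub]

theorem isContiguous_quadSum : IsContiguous zVar qVar quadSum where
  r₁_sub_r₂ a₁ a₂ b₁ b₂ := by
    rw [← pow_one zVar]
    refine quadSum_sub_eq 1 _ (g := fun x => (x.1 + 1, x.2)) (fun x y h => ?_)
      (fun ⟨r₁, r₂, s₁, s₂⟩ hx => ?_) fun ⟨r₁, r₂, s₁, s₂⟩ => ?_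
    · simp only [Prod.mk.injEq, add_left_inj] at h
      exact Prod.ext h.1 h.2
    · obtain rfl : r₁ = 0 := by
        by_contra h
        exact hx ⟨(r₁ - 1, r₂, s₁, s₂), by simp; omega⟩
      rcases Nat.eq_zero_or_pos r₂ with rfl | h
      · rw [← sub_eq_zero, quadTerm_sub, quadCoeff_sub_r₁_sub_r₂ a₁ a₂ b₁ b₂ 0 0,
          invQPoch_of_neg (by simp)]
        simp
      · rw [quadTerm_eq_zero (.inl h), quadTerm_eq_zero (.inl h)]
    · rcases lt_or_ge (r₁ + 1) r₂ with h | h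
      · rw [quadTerm_eq_zero (.inl h), quadTerm_eq_zero (.inl h),
          quadTerm_eq_zero (.inl (by dsimp only; omega)), mul_zero, sub_zero]
      -- The value m = 0 needs no separate case: both sides then carry 1/(q;q)_{-1} = 0.
      · obtain ⟨m, hm⟩ := Nat.exists_eq_add_of_le h
        rw [quadTerm_sub]
        dsimp only
        rw [hm, quadCoeff_sub_r₁_sub_r₂, quadTerm, quadCoeff, qVar, ← hm,
          show (m : ℤ) - 1 = r₁ - r₂ by omega]
        simp only [map_mul, map_pow]
        ring
  r₂ a₁ a₂ b₁ b₂ := by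
    -- Lowering r₂ in (q;q)_{r₂} must leave r₁ - r₂ unchanged, so r₁ and r₂ are shifted together;
    -- hence the factor z².
    refine quadSum_sub_eq 2 _ (g := fun x => (x.1 + 1, x.2.1 + 1, x.2.2)) (fun x y h => ?_)
      (fun ⟨r₁, r₂, s₁, s₂⟩ hx => ?_) fun ⟨r₁, r₂, s₁, s₂⟩ => ?_
    · simp only [Prod.mk.injEq, add_left_inj] at h
      exact Prod.ext h.1 (Prod.ext h.2.1 h.2.2)
    · rcases lt_or_ge r₁ r₂ with h | h
      · rw [quadTerm_eq_zero (.inl h), quadTerm_eq_zero (.inl h)]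
      · obtain rfl : r₂ = 0 := by
          by_contra h
          exact hx ⟨(r₁ - 1, r₂ - 1, s₁, s₂), by simp; omega⟩
        rw [← sub_eq_zero, quadTerm_sub, quadCoeff_sub_r₂,
          invQPoch_of_neg (m := ((0 : ℕ) : ℤ) - 1) (by simp)]
        simp
    · rw [quadTerm_sub, quadCoeff_sub_r₂, quadTerm, quadCoeff, qVar]
      dsimp only
      rw [show ((r₂ + 1 : ℕ) : ℤ) - 1 = r₂ by omega,
        show ((r₁ + 1 : ℕ) : ℤ) - ((r₂ + 1 : ℕ) : ℤ) = r₁ - r₂ by omega]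
      simp only [map_mul, map_pow]
      ring
  s₁ a₁ a₂ b₁ b₂ := by
    refine quadSum_sub_eq 2 _ (g := fun x => (x.1, x.2.1, x.2.2.1 + 1, x.2.2.2 + 1))
      (fun x y h => ?_) (fun ⟨r₁, r₂, s₁, s₂⟩ hx => ?_) fun ⟨r₁, r₂, s₁, s₂⟩ => ?_
    · simp only [Prod.mk.injEq, add_left_inj] at h
      exact Prod.ext h.1 (Prod.ext h.2.1 (Prod.ext h.2.2.1 h.2.2.2))
    · rcases lt_or_ge s₂ s₁ with h | h
      · rw [quadTerm_eq_zero (.inr h), quadTerm_eq_zero (.inr h)]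
      · obtain rfl : s₁ = 0 := by
          by_contra h
          exact hx ⟨(r₁, r₂, s₁ - 1, s₂ - 1), by simp; omega⟩
        rw [← sub_eq_zero, quadTerm_sub, quadCoeff_sub_s₁,
          invQPoch_of_neg (m := ((0 : ℕ) : ℤ) - 1) (by simp)]
        simp
    · rw [quadTerm_sub, quadCoeff_sub_s₁, quadTerm, quadCoeff, qVar]
      dsimp only
      rw [show ((s₁ + 1 : ℕ) : ℤ) - 1 = s₁ by omega,
        show ((s₂ + 1 : ℕ) : ℤ) - ((s₁ + 1 : ℕ) : ℤ) = s₂ - s₁ by omega]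
      simp only [map_mul, map_pow]
      ring
  s₂_sub_s₁ a₁ a₂ b₁ b₂ := by
    rw [← pow_one zVar]
    refine quadSum_sub_eq 1 _ (g := fun x => (x.1, x.2.1, x.2.2.1, x.2.2.2 + 1))
      (fun x y h => ?_) (fun ⟨r₁, r₂, s₁, s₂⟩ hx => ?_) fun ⟨r₁, r₂, s₁, s₂⟩ => ?_
    · simp only [Prod.mk.injEq, add_left_inj] at h
      exact Prod.ext h.1 (Prod.ext h.2.1 (Prod.ext h.2.2.1 h.2.2.2))
    · obtain rfl : s₂ = 0 := by
        by_contra h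
        exact hx ⟨(r₁, r₂, s₁, s₂ - 1), by simp; omega⟩
      rcases Nat.eq_zero_or_pos s₁ with rfl | h
      · rw [← sub_eq_zero, quadTerm_sub, quadCoeff_sub_s₂_sub_s₁ a₁ a₂ b₁ b₂ r₁ r₂ 0 0,
          invQPoch_of_neg (m := ((0 : ℕ) : ℤ) - 1) (by simp)]
        simp
      · rw [quadTerm_eq_zero (.inr h), quadTerm_eq_zero (.inr h)]
    · rcases lt_or_ge (s₂ + 1) s₁ with h | h
      · rw [quadTerm_eq_zero (.inr h), quadTerm_eq_zero (.inr h),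
          quadTerm_eq_zero (.inr (by dsimp only; omega)), mul_zero, sub_zero]
      · obtain ⟨m, hm⟩ := Nat.exists_eq_add_of_le h
        rw [quadTerm_sub]
        dsimp only
        rw [hm, quadCoeff_sub_s₂_sub_s₁, quadTerm, quadCoeff, qVar, ← hm,
          show (m : ℤ) - 1 = s₂ - s₁ by omega]
        simp only [map_mul, map_pow]
        ring

/-! ### The substitution z ↦ zq² on power series. -/

theorem PowerSeries.WithPiTopology.hasSum_rescale {R ι : Type*} [CommRing R] [TopologicalSpace R]
    [IsTopologicalRing R] (r : R) {f : ι → R⟦X⟧} {g : R⟦X⟧} (h : HasSum f g) :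
    HasSum (fun i => PowerSeries.rescale r (f i)) (PowerSeries.rescale r g) := by
  rw [PowerSeries.WithPiTopology.hasSum_iff_hasSum_coeff] at h ⊢
  intro d
  simpa only [PowerSeries.coeff_rescale] using (h d).mul_left (r ^ d)

theorem rescale_zVar : PowerSeries.rescale (PowerSeries.X ^ 2 : ℤ⟦X⟧) zVar = zVar * qVar ^ 2 := by
  rw [zVar, PowerSeries.rescale_X, qVar, ← map_pow, mul_comm]

theorem rescale_qVar (r : ℤ⟦X⟧) : PowerSeries.rescale r qVar = qVar := by
  ext n : 1
  rw [PowerSeries.coeff_rescale, qVar, PowerSeries.coeff_C]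
  split_ifs with h
  · rw [h, pow_zero, one_mul]
  · rw [mul_zero]

/-! ### Removing the smallest parts of an admissible partition. -/

namespace ColouredPartition

/-- Shift all parts of `p` up by `2` and add `b` parts `1` of colour label `2`, `x` parts `2` of
colour label `1` and `y` parts `2` of colour label `3`. -/
noncomputable def prepend (x y b : ℕ) (p : ColouredPartition 3) : ColouredPartition 3 where
  freq := p.freq.mapDomain (Prod.map id (· + 2)) + Finsupp.single (1, 1) b +
    Finsupp.single (0, 2) x + Finsupp.single (2, 2) y
  freq_zero c := by
    rw [Finsupp.add_apply, Finsupp.add_apply, Finsupp.add_apply, Finsupp.mapDomain_of_notMem_range]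
    · simp
    · rintro ⟨⟨c', i⟩, h⟩
      simp at h

theorem prepend_freq_add_two (x y b : ℕ) (p : ColouredPartition 3) (c : Fin 3) (i : ℕ) :
    (prepend x y b p).freq (c, i + 2) = p.freq (c, i) +
      (if c = 0 ∧ i = 0 then x else 0) + (if c = 2 ∧ i = 0 then y else 0) := by
  have hinj : Function.Injective (Prod.map id (· + 2) : Fin 3 × ℕ → Fin 3 × ℕ) :=
    Function.injective_id.prodMap (add_left_injective 2)
  have h := Finsupp.mapDomain_apply hinj p.freq (c, i)
  simp only [Prod.map_apply, id] at h
  simp only [prepend, Finsupp.add_apply, h, Finsupp.single_apply, Prod.mk.injEq]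
  simp [eq_comm]

theorem prepend_freq_one (x y b : ℕ) (p : ColouredPartition 3) (c : Fin 3) :
    (prepend x y b p).freq (c, 1) = if c = 1 then b else 0 := by
  simp only [prepend, Finsupp.add_apply]
  rw [Finsupp.mapDomain_of_notMem_range]
  · simp [Finsupp.single_apply, eq_comm]
  · rintro ⟨⟨c', i⟩, h⟩
    simp at h

theorem prepend_length (x y b : ℕ) (p : ColouredPartition 3) :
    (prepend x y b p).length = b + x + y + p.length := by
  simp only [length, prepend]
  repeat rw [Finsupp.sum_add_index' (fun _ => rfl) (fun _ _ _ => rfl)]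
  rw [Finsupp.sum_mapDomain_index (fun _ => rfl) (fun _ _ _ => rfl)]
  repeat rw [Finsupp.sum_single_index rfl]
  ring

theorem prepend_size (x y b : ℕ) (p : ColouredPartition 3) :
    (prepend x y b p).size = b + 2 * (x + y) + (p.size + 2 * p.length) := by
  simp only [size, length, prepend]
  repeat rw [Finsupp.sum_add_index' (fun _ => mul_zero _) (fun _ _ _ => mul_add _ _ _)]
  rw [Finsupp.sum_mapDomain_index (fun _ => mul_zero _) (fun _ _ _ => mul_add _ _ _)]
  repeat rw [Finsupp.sum_single_index (mul_zero _)]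
  simp only [Prod.map_snd, add_mul, Finsupp.sum, Finset.sum_add_distrib, Finset.mul_sum]
  ring

/-- The entry in column `2 * u` of the row of colour `c` with boundary value `x`. -/
def evenEntry (x : ℕ) (p : ColouredPartition 3) (c : Fin 3) (u : ℕ) : ℕ :=
  if u = 0 then x else p.freq (c, 2 * u)

/-- The frequency conditions for three colours at level `K`, with boundary values `x` and `y` in
the rows with colour labels `1` and `3`. -/
def IsAdmissible (K x y : ℕ) (p : ColouredPartition 3) : Prop :=
  (∀ c i, p.freq (c, i) ≠ 0 → Odd (i + (c.val + 1))) ∧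
    ∀ m u v, (u = m ∨ u = m + 1) → (v = m ∨ v = m + 1) →
      evenEntry x p 0 u + p.freq (1, 2 * m + 1) + evenEntry y p 2 v ≤ K

/-- A path has middle index 2m + 1 and outer indices in {2m, 2m + 2}, or it is (0, -1, 0). The
latter has sum exactly K, so k₁ imposes no condition beyond fixing the level. -/
theorem mem_dPartitions_iff {K x y : ℕ} (h : x + y ≤ K) (p : ColouredPartition 3) :
    p ∈ dPartitions 2 ![x, K - x - y, y] ↔ IsAdmissible K x y p := by
  have hsum : ∑ j, ![x, K - x - y, y] j = K := by
    simp [Fin.sum_univ_three]; omega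
  have he0 : ∀ u : ℕ, arrayEntry ![x, K - x - y, y] p 0 (2 * u) = evenEntry x p 0 u := by
    intro u
    rw [arrayEntry, if_neg (by omega), evenEntry]
    rcases Nat.eq_zero_or_pos u with rfl | hu
    · simp
    · rw [if_neg (by omega), if_neg (by omega)]
      congr 2
  have he2 : ∀ u : ℕ, arrayEntry ![x, K - x - y, y] p 2 (2 * u) = evenEntry y p 2 u := by
    intro u
    rw [arrayEntry, if_neg (by omega), evenEntry]
    rcases Nat.eq_zero_or_pos u with rfl | hu
    · simp [Fin.last]
    · rw [if_neg (by omega), if_neg (by omega)]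
      congr 2
  have he1 : ∀ u : ℕ, arrayEntry ![x, K - x - y, y] p 1 (2 * u + 1) = p.freq (1, 2 * u + 1) := by
    intro u
    rw [arrayEntry, if_neg (by omega), if_neg (by omega)]
    congr 2
  have hexp : ∀ i : Fin (2 * 2 - 1) → ℤ, ∑ c, arrayEntry ![x, K - x - y, y] p c (i c) =
      arrayEntry ![x, K - x - y, y] p 0 (i 0) + arrayEntry ![x, K - x - y, y] p 1 (i 1) +
      arrayEntry ![x, K - x - y, y] p 2 (i 2) := fun i => Fin.sum_univ_three _
  rw [dPartitions, Set.mem_ofPred_eq, hsum, IsAdmissible]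
  refine and_congr_right fun _ => ⟨fun H m u v hu hv => ?_, fun H i hi => ?_⟩
  · have hp : IsPath (n := 2) ![2 * (u : ℤ), 2 * m + 1, 2 * v] := by
      refine ⟨fun c => ?_, fun c => ?_, fun c d hcd => ?_⟩
      · change Fin 3 at c
        fin_cases c <;> simp
        all_goals omega
      · change Fin 3 at c
        rw [Int.odd_iff]
        fin_cases c <;> simp
      · change Fin 3 at c d
        rw [abs_eq (by norm_num)]
        fin_cases c <;> fin_cases d <;> simp at hcd ⊢ <;> omega
    have := H _ hp
    rw [hexp] at this
    rwa [← he0, ← he1, ← he2]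
  · rw [hexp]
    have o0 := hi.odd 0
    have o1 := hi.odd 1
    have o2 := hi.odd 2
    have n0 := hi.neg_one_le 0
    have n1 := hi.neg_one_le 1
    have n2 := hi.neg_one_le 2
    have s0 := hi.step 0 1 rfl
    have s1 := hi.step 1 2 rfl
    rw [abs_eq (by norm_num)] at s0 s1
    rw [Int.odd_iff] at o0 o1 o2
    change (i 0 + (((0 : ℕ) : ℤ) + 1)) % 2 = 1 at o0
    change (i 1 + (((1 : ℕ) : ℤ) + 1)) % 2 = 1 at o1
    change (i 2 + (((2 : ℕ) : ℤ) + 1)) % 2 = 1 at o2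
    obtain ⟨u, hu⟩ : ∃ u : ℕ, i 0 = 2 * u := ⟨(i 0 / 2).toNat, by omega⟩
    obtain ⟨v, hv⟩ : ∃ v : ℕ, i 2 = 2 * v := ⟨(i 2 / 2).toNat, by omega⟩
    rcases eq_or_ne (i 1) (-1) with h1 | h1
    · obtain rfl : u = 0 := by omega
      obtain rfl : v = 0 := by omega
      rw [hu, hv, he0, he2, h1]
      have : arrayEntry ![x, K - x - y, y] p 1 (-1) = K - x - y := by
        rw [arrayEntry, if_pos rfl]; rfl
      rw [this, evenEntry, evenEntry, if_pos rfl, if_pos rfl]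
      omega
    · obtain ⟨m, hm⟩ : ∃ m : ℕ, i 1 = 2 * m + 1 := ⟨(i 1 / 2).toNat, by omega⟩
      rw [hu, hv, hm, he0, he1, he2]
      exact H m u v (by omega) (by omega)

theorem evenEntry_prepend (x₀ x y b : ℕ) (p : ColouredPartition 3) (u : ℕ) :
    evenEntry x₀ (prepend x y b p) 0 (u + 1) = evenEntry x p 0 u ∧
    evenEntry x₀ (prepend x y b p) 2 (u + 1) = evenEntry y p 2 u := by
  simp only [evenEntry, if_neg (Nat.succ_ne_zero u), mul_add, mul_one, prepend_freq_add_two]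
  rcases Nat.eq_zero_or_pos u with rfl | hu
  · simp [p.freq_zero]
  · simp [hu.ne']

/-- The four paths through column 1 amount to the inequality with the two maxima. All other paths
are paths for p moved by two columns, the new entries in column 2 serving as boundary values of p.
-/
theorem isAdmissible_prepend_iff {K x₀ y₀ x y b : ℕ} {p : ColouredPartition 3} :
    IsAdmissible K x₀ y₀ (prepend x y b p) ↔
      b + max x₀ x + max y₀ y ≤ K ∧ IsAdmissible K x y p := by
  have e0 := fun u => (evenEntry_prepend x₀ x y b p u).1
  have e2 := fun u => (evenEntry_prepend y₀ x y b p u).2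
  have f1 : ∀ m, (prepend x y b p).freq (1, 2 * (m + 1) + 1) = p.freq (1, 2 * m + 1) := by
    intro m
    rw [show 2 * (m + 1) + 1 = 2 * m + 1 + 2 by ring, prepend_freq_add_two]
    simp
  have z0 : evenEntry x₀ (prepend x y b p) 0 0 = x₀ := if_pos rfl
  have z2 : evenEntry y₀ (prepend x y b p) 2 0 = y₀ := if_pos rfl
  have z0' : evenEntry x p 0 0 = x := if_pos rfl
  have z2' : evenEntry y p 2 0 = y := if_pos rfl
  have g1 : (prepend x y b p).freq (1, 2 * 0 + 1) = b := prepend_freq_one x y b p 1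
  constructor
  · rintro ⟨H1, H2⟩
    refine ⟨?_, fun c i hc => ?_, fun m u v hu hv => ?_⟩
    · have a1 := H2 0 0 0 (.inl rfl) (.inl rfl)
      have a2 := H2 0 (0 + 1) 0 (.inr rfl) (.inl rfl)
      have a3 := H2 0 0 (0 + 1) (.inl rfl) (.inr rfl)
      have a4 := H2 0 (0 + 1) (0 + 1) (.inr rfl) (.inr rfl)
      simp only [e0, e2, z0, z2, z0', z2', g1] at a1 a2 a3 a4
      omega
    · have := H1 c (i + 2) (by rw [prepend_freq_add_two]; omega)
      rw [Nat.odd_iff] at this ⊢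
      omega
    · have := H2 (m + 1) (u + 1) (v + 1) (by omega) (by omega)
      rwa [e0, e2, f1] at this
  · rintro ⟨H0, H1, H2⟩
    refine ⟨fun c i hc => ?_, fun m u v hu hv => ?_⟩
    · match i with
      | 0 => exact absurd (freq_zero _ c) hc
      | 1 =>
        rw [prepend_freq_one] at hc
        have : c = 1 := by by_contra h; simp [h] at hc
        subst this
        decide
      | i + 2 =>
        rw [prepend_freq_add_two] at hc
        by_cases h : p.freq (c, i) = 0
        · have : (c = 0 ∨ c = 2) ∧ i = 0 := by
            by_contra h'
            apply hc
            rw [h, if_neg (by tauto), if_neg (by tauto)]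
          obtain ⟨rfl | rfl, rfl⟩ := this <;> decide
        · have := H1 c i h
          rw [Nat.odd_iff] at this ⊢
          omega
    · match m with
      | 0 =>
        have hu' : evenEntry x₀ (prepend x y b p) 0 u ≤ max x₀ x := by
          rcases hu with rfl | rfl
          · rw [z0]; exact le_max_left _ _
          · rw [e0, z0']; exact le_max_right _ _
        have hv' : evenEntry y₀ (prepend x y b p) 2 v ≤ max y₀ y := by
          rcases hv with rfl | rfl
          · rw [z2]; exact le_max_left _ _
          · rw [e2, z2']; exact le_max_right _ _
        rw [g1]
        omega
      | m + 1 =>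
        obtain ⟨u, rfl⟩ : ∃ u', u = u' + 1 := ⟨u - 1, by omega⟩
        obtain ⟨v, rfl⟩ : ∃ v', v = v' + 1 := ⟨v - 1, by omega⟩
        rw [e0, e2, f1]
        exact H2 m u v (by omega) (by omega)

theorem prepend_injective {x y b x' y' b' : ℕ} {p p' : ColouredPartition 3}
    (h : prepend x y b p = prepend x' y' b' p') : x = x' ∧ y = y' ∧ b = b' ∧ p = p' := by
  have key : ∀ c i, (prepend x y b p).freq (c, i) = (prepend x' y' b' p').freq (c, i) :=
    fun c i => by rw [h]
  have hx := key 0 (0 + 2)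
  have hy := key 2 (0 + 2)
  have hb := key 1 1
  simp only [prepend_freq_add_two, freq_zero, prepend_freq_one] at hx hy hb
  simp at hx hy hb
  refine ⟨hx, hy, hb, ColouredPartition.ext (Finsupp.ext fun ⟨c, i⟩ => ?_)⟩
  rcases Nat.eq_zero_or_pos i with rfl | hi
  · rw [freq_zero, freq_zero]
  · have := key c (i + 2)
    rw [prepend_freq_add_two, prepend_freq_add_two] at this
    simpa [hi.ne'] using this

theorem exists_eq_prepend {p : ColouredPartition 3}
    (h : ∀ c i, p.freq (c, i) ≠ 0 → Odd (i + (c.val + 1))) :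
    ∃ x y b p', p = prepend x y b p' := by
  have hinj : Function.Injective (Prod.map id (· + 2) : Fin 3 × ℕ → Fin 3 × ℕ) :=
    Function.injective_id.prodMap (add_left_injective 2)
  refine ⟨p.freq (0, 2), p.freq (2, 2), p.freq (1, 1),
    -- Parts 2 would become parts 0 and are filtered out; they are recorded in x and y. Parity
    -- excludes parts 1 of colours 1 and 3 and parts 2 of colour 2.
    ⟨(p.freq.comapDomain (Prod.map id (· + 2)) hinj.injOn).filter (fun a => a.2 ≠ 0),
      fun c => by simp⟩, ?_⟩
  refine ColouredPartition.ext (Finsupp.ext fun ⟨c, i⟩ => ?_)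
  have hz : ∀ c i, ¬ Odd (i + (c.val + 1)) → p.freq (c, i) = 0 :=
    fun c i hc => not_not.1 fun h0 => hc (h c i h0)
  match i with
  | 0 => rw [freq_zero, freq_zero]
  | 1 =>
    rw [prepend_freq_one]
    fin_cases c
    · exact hz _ _ (by decide)
    · rfl
    · exact hz _ _ (by decide)
  | i + 2 =>
    rw [prepend_freq_add_two]
    rcases Nat.eq_zero_or_pos i with rfl | hi
    · fin_cases c
      · simp
      · simpa using hz 1 2 (by decide)
      · simp
    · simp [hi.ne']

end ColouredPartition

/-! ### The transfer system for the generating functions. -/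

open ColouredPartition

/-- The pairs of boundary values at level `K`. -/
def levelPairs (K : ℕ) : Finset (ℕ × ℕ) :=
  (Finset.range (K + 1) ×ˢ Finset.range (K + 1)).filter fun i => i.1 + i.2 ≤ K

theorem mem_levelPairs {K : ℕ} {i : ℕ × ℕ} : i ∈ levelPairs K ↔ i.1 + i.2 ≤ K := by
  simp only [levelPairs, Finset.mem_filter, Finset.mem_product, Finset.mem_range]
  omega

/-- The entries of the transfer matrix of the frequency conditions at level `K`. -/
noncomputable def transfer (K : ℕ) (i j : ℕ × ℕ) : ℤ⟦X⟧⟦X⟧ :=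
  -- Here b counts the parts 1. Truncated subtraction makes the range empty, hence the entry 0, when
  -- the maxima add up to more than K.
  ∑ b ∈ Finset.range (K + 1 - (max i.1 j.1 + max i.2 j.2)),
    zVar ^ (b + j.1 + j.2) * qVar ^ (b + 2 * (j.1 + j.2))

/-- The generating function at level `K` as a function of the boundary values. -/
noncomputable def levelGenFun (K : ℕ) (i : ℕ × ℕ) : ℤ⟦X⟧⟦X⟧ :=
  dGenFun 2 ![i.1, K - i.1 - i.2, i.2]

theorem hasSum_levelGenFun {K : ℕ} {i : ℕ × ℕ} (hi : i ∈ levelPairs K) :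
    HasSum (fun p : {p : ColouredPartition 3 // IsAdmissible K i.1 i.2 p} =>
      zVar ^ p.val.length * qVar ^ p.val.size) (levelGenFun K i) :=
  (Equiv.subtypeEquivRight fun p =>
    (mem_dPartitions_iff (mem_levelPairs.1 hi) p).symm).hasSum_iff.2 (hasSum_dGenFun 2 _)

theorem HasSum.eq_sum_of_bijective_sigma {T γ M : Type*} [Fintype T] {β : T → Type*}
    [AddCommMonoid M] [TopologicalSpace M] [ContinuousAdd M] [T3Space M]
    {φ : (Σ t, β t) → γ} (hφ : Function.Bijective φ) {f : γ → M} {a : M} (hf : HasSum f a)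
    {g : T → M} (hg : ∀ t, HasSum (fun p => f (φ ⟨t, p⟩)) (g t)) : a = ∑ t, g t :=
  (((Equiv.ofBijective φ hφ).hasSum_iff.2 hf).sigma hg).unique (hasSum_fintype g)

/-- Raising every part of p by 2 contributes q^{2 l(p)}, which is the substitution z ↦ zq². -/
theorem hasSum_prepend {K b : ℕ} {j : ℕ × ℕ} (hj : j ∈ levelPairs K) :
    HasSum (fun p : {p : ColouredPartition 3 // IsAdmissible K j.1 j.2 p} =>
      zVar ^ (prepend j.1 j.2 b p.val).length * qVar ^ (prepend j.1 j.2 b p.val).size)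
      (zVar ^ (b + j.1 + j.2) * qVar ^ (b + 2 * (j.1 + j.2)) *
        PowerSeries.rescale (PowerSeries.X ^ 2) (levelGenFun K j)) := by
  refine ((PowerSeries.WithPiTopology.hasSum_rescale (PowerSeries.X ^ 2 : ℤ⟦X⟧)
    (hasSum_levelGenFun hj)).mul_left _).congr_fun fun p => ?_
  rw [prepend_length, prepend_size, map_mul, map_pow, map_pow, rescale_zVar, rescale_qVar]
  ring

/-- The values of the first boundary entries and of the number of parts `1` that can follow the
boundary values `i` at level `K`. -/
def heads (K : ℕ) (i : ℕ × ℕ) : Finset (Σ _ : ℕ × ℕ, ℕ) :=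
  (levelPairs K).sigma fun j => Finset.range (K + 1 - (max i.1 j.1 + max i.2 j.2))

theorem mem_heads {K : ℕ} {i : ℕ × ℕ} {t : Σ _ : ℕ × ℕ, ℕ} :
    t ∈ heads K i ↔ t.2 + max i.1 t.1.1 + max i.2 t.1.2 ≤ K := by
  obtain ⟨⟨x, y⟩, b⟩ := t
  simp only [heads, Finset.mem_sigma, mem_levelPairs, Finset.mem_range]
  omega

/-- An admissible partition is obtained from its first entries and the shifted rest. -/
noncomputable def prependHead (K : ℕ) (i : ℕ × ℕ)
    (a : Σ t : heads K i, {p : ColouredPartition 3 // IsAdmissible K t.1.1.1 t.1.1.2 p}) :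
    {p : ColouredPartition 3 // IsAdmissible K i.1 i.2 p} :=
  ⟨prepend a.1.1.1.1 a.1.1.1.2 a.1.1.2 a.2.1,
    isAdmissible_prepend_iff.2 ⟨mem_heads.1 a.1.2, a.2.2⟩⟩

theorem prependHead_bijective (K : ℕ) (i : ℕ × ℕ) : Function.Bijective (prependHead K i) := by
  constructor
  · rintro ⟨⟨⟨⟨x, y⟩, b⟩, ht⟩, p, hp⟩ ⟨⟨⟨⟨x', y'⟩, b'⟩, ht'⟩, p', hp'⟩ h
    obtain ⟨h1, h2, h3, h4⟩ := prepend_injective (congrArg Subtype.val h)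
    dsimp only at h1 h2 h3 h4
    subst h1 h2 h3 h4
    rfl
  · rintro ⟨p, hp⟩
    obtain ⟨x, y, b, p', rfl⟩ := exists_eq_prepend hp.1
    obtain ⟨h1, h2⟩ := isAdmissible_prepend_iff.1 hp
    exact ⟨⟨⟨⟨⟨x, y⟩, b⟩, mem_heads.2 h1⟩, ⟨p', h2⟩⟩, rfl⟩

theorem hasSum_prependHead {K : ℕ} {i : ℕ × ℕ} (t : heads K i) :
    HasSum (fun p : {p : ColouredPartition 3 // IsAdmissible K t.1.1.1 t.1.1.2 p} =>
      zVar ^ (prependHead K i ⟨t, p⟩).val.length * qVar ^ (prependHead K i ⟨t, p⟩).val.size)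
      (zVar ^ (t.1.2 + t.1.1.1 + t.1.1.2) * qVar ^ (t.1.2 + 2 * (t.1.1.1 + t.1.1.2)) *
        PowerSeries.rescale (PowerSeries.X ^ 2) (levelGenFun K t.1.1)) := by
  simp only [prependHead]
  exact hasSum_prepend (Finset.mem_sigma.1 t.2).1

/-- Admissible partitions are classified by their head (j, b); summing over b for fixed j gives the
matrix entry. -/
theorem levelGenFun_eq_sum {K : ℕ} {i : ℕ × ℕ} (hi : i ∈ levelPairs K) :
    levelGenFun K i = ∑ j ∈ levelPairs K,
      transfer K i j * PowerSeries.rescale (PowerSeries.X ^ 2) (levelGenFun K j) := by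
  have h : levelGenFun K i = ∑ t : heads K i,
      zVar ^ (t.1.2 + t.1.1.1 + t.1.1.2) * qVar ^ (t.1.2 + 2 * (t.1.1.1 + t.1.1.2)) *
        PowerSeries.rescale (PowerSeries.X ^ 2) (levelGenFun K t.1.1) :=
    HasSum.eq_sum_of_bijective_sigma (prependHead_bijective K i) (hasSum_levelGenFun hi)
      hasSum_prependHead
  rw [Finset.univ_eq_attach] at h
  rw [h, Finset.sum_attach (heads K i) (fun t : (Σ _ : ℕ × ℕ, ℕ) =>
    zVar ^ (t.2 + t.1.1 + t.1.2) * qVar ^ (t.2 + 2 * (t.1.1 + t.1.2)) *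
      PowerSeries.rescale (PowerSeries.X ^ 2) (levelGenFun K t.1)), heads, Finset.sum_sigma]
  refine Finset.sum_congr rfl fun j _ => ?_
  rw [transfer, Finset.sum_mul]

/-! ### Uniqueness of the solution of the transfer system. -/

/-- Once the coefficients of degree below l in z vanish, the system in degree l reads w_i = q^{2l}
w_{i₀} for all i. Taking i = i₀ with l > 0 gives (1 - q^{2l}) w_{i₀} = 0 in a domain; degree 0 is
the hypothesis on the constant term. -/
theorem eq_zero_of_eq_sum_rescale {ι : Type*} [DecidableEq ι] {s : Finset ι} {i₀ : ι}
    (hi₀ : i₀ ∈ s) {M : ι → ι → ℤ⟦X⟧⟦X⟧}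
    (hM : ∀ i ∈ s, ∀ j ∈ s, PowerSeries.constantCoeff (M i j) = if j = i₀ then 1 else 0)
    {W : ι → ℤ⟦X⟧⟦X⟧} (h0 : PowerSeries.constantCoeff (W i₀) = 0)
    (hW : ∀ i ∈ s, W i = ∑ j ∈ s, M i j * PowerSeries.rescale (PowerSeries.X ^ 2) (W j)) :
    ∀ i ∈ s, W i = 0 := by
  suffices H : ∀ l, ∀ i ∈ s, PowerSeries.coeff l (W i) = 0 from
    fun i hi => PowerSeries.ext fun l => by rw [H l i hi, map_zero]
  intro l
  induction l using Nat.strong_induction_on with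
  | _ l ih =>
    have key : ∀ i ∈ s, PowerSeries.coeff l (W i) =
        (PowerSeries.X ^ 2) ^ l * PowerSeries.coeff l (W i₀) := by
      intro i hi
      conv_lhs => rw [hW i hi]
      rw [map_sum]
      have hterm : ∀ j ∈ s, PowerSeries.coeff l
          (M i j * PowerSeries.rescale (PowerSeries.X ^ 2) (W j)) =
          if j = i₀ then (PowerSeries.X ^ 2) ^ l * PowerSeries.coeff l (W j) else 0 := by
        intro j hj
        rw [PowerSeries.coeff_mul, Finset.sum_eq_single (0, l)]
        · rw [PowerSeries.coeff_zero_eq_constantCoeff_apply, hM i hi j hj,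
            PowerSeries.coeff_rescale, ite_mul, one_mul, zero_mul]
        · rintro ⟨a, b⟩ hab hne
          rw [Finset.HasAntidiagonal.mem_antidiagonal] at hab
          dsimp only at hab ⊢
          have hb : b < l := by
            rcases Nat.eq_zero_or_pos a with rfl | ha
            · exact absurd (by rw [← hab, zero_add]) hne
            · omega
          rw [PowerSeries.coeff_rescale, ih b hb j hj, mul_zero, mul_zero]
        · intro h
          exact absurd (Finset.HasAntidiagonal.mem_antidiagonal.2 (zero_add l)) h
      rw [Finset.sum_congr rfl hterm, Finset.sum_ite_eq' s i₀, if_pos hi₀]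
    have hl : PowerSeries.coeff l (W i₀) = 0 := by
      rcases Nat.eq_zero_or_pos l with rfl | hl
      · rw [PowerSeries.coeff_zero_eq_constantCoeff_apply, h0]
      · have h1 := key i₀ hi₀
        have h2 : (1 - (PowerSeries.X ^ 2) ^ l : ℤ⟦X⟧) * PowerSeries.coeff l (W i₀) = 0 := by
          rw [sub_mul, one_mul, ← h1, sub_self]
        refine (mul_eq_zero.1 h2).resolve_left fun h3 => ?_
        have h4 := congrArg PowerSeries.constantCoeff h3
        simp [hl.ne'] at h4
    intro i hi
    rw [key i hi, hl, mul_zero]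

theorem eq_of_eq_sum_rescale {ι : Type*} [DecidableEq ι] {s : Finset ι} {i₀ : ι}
    (hi₀ : i₀ ∈ s) {M : ι → ι → ℤ⟦X⟧⟦X⟧}
    (hM : ∀ i ∈ s, ∀ j ∈ s, PowerSeries.constantCoeff (M i j) = if j = i₀ then 1 else 0)
    {U V : ι → ℤ⟦X⟧⟦X⟧}
    (h0 : PowerSeries.constantCoeff (U i₀) = PowerSeries.constantCoeff (V i₀))
    (hU : ∀ i ∈ s, U i = ∑ j ∈ s, M i j * PowerSeries.rescale (PowerSeries.X ^ 2) (U j))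
    (hV : ∀ i ∈ s, V i = ∑ j ∈ s, M i j * PowerSeries.rescale (PowerSeries.X ^ 2) (V j)) :
    ∀ i ∈ s, U i = V i := fun i hi =>
  sub_eq_zero.1 (eq_zero_of_eq_sum_rescale (W := fun i => U i - V i) hi₀ hM
    (by rw [map_sub, h0, sub_self])
    (fun i hi => by simp only [map_sub, mul_sub, Finset.sum_sub_distrib, ← hU i hi, ← hV i hi])
    i hi)

theorem constantCoeff_transfer {K : ℕ} {i j : ℕ × ℕ} (hi : i ∈ levelPairs K) :
    PowerSeries.constantCoeff (transfer K i j) = if j = 0 then 1 else 0 := by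
  have hi := mem_levelPairs.1 hi
  rw [transfer, map_sum]
  simp only [map_mul, map_pow, zVar, PowerSeries.constantCoeff_X, zero_pow_eq, ite_mul, one_mul,
    zero_mul, qVar, PowerSeries.constantCoeff_C]
  split_ifs with hj
  · subst hj
    rw [Finset.sum_eq_single 0]
    · simp
    · intro b _ hb
      rw [if_neg]
      simpa using hb
    · intro h
      simp at h
      omega
  · refine Finset.sum_eq_zero fun b _ => if_neg fun h => hj ?_
    ext <;> simp <;> omega

theorem constantCoeff_levelGenFun (K : ℕ) :
    PowerSeries.constantCoeff (levelGenFun K 0) = 1 := by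
  have h := hasSum_levelGenFun (K := K) (i := 0) (mem_levelPairs.2 (Nat.zero_le _))
  have hadm : IsAdmissible K (0 : ℕ × ℕ).1 (0 : ℕ × ℕ).2 ⟨0, fun _ => rfl⟩ := by
    refine ⟨fun c i hc => absurd rfl hc, fun m u v _ _ => ?_⟩
    simp [evenEntry]
  rw [PowerSeries.WithPiTopology.hasSum_iff_hasSum_coeff] at h
  rw [← PowerSeries.coeff_zero_eq_constantCoeff_apply]
  refine (h 0).unique ?_
  convert hasSum_single (⟨⟨0, fun _ => rfl⟩, hadm⟩ :
    {p : ColouredPartition 3 // IsAdmissible K (0 : ℕ × ℕ).1 (0 : ℕ × ℕ).2 p}) fun p hp => ?_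
  · simp [ColouredPartition.length, ColouredPartition.size]
  · have hne : p.val.length ≠ 0 := fun h0 => hp (Subtype.ext (ColouredPartition.ext
      (Finsupp.ext fun a => by
        by_contra ha
        exact ha (Finset.sum_eq_zero_iff.1 h0 a (Finsupp.mem_support_iff.2 ha)))))
    simp [zVar, hne]

/-! ### The solution at level 2. -/

/-- The multisum expressions for the generating functions at level `2`. -/
noncomputable def levelTwoSum : ℕ × ℕ → ℤ⟦X⟧⟦X⟧
  | (0, 0) => quadSum 0 0 0 0
  | (1, 1) => quadSum 1 1 0 2 + zVar * qVar ^ 2 * quadSum 2 2 2 4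
  -- Exchanging colours 1 and 3 swaps the boundary values, so both orders share one formula. At
  -- level 2 the last case covers (2, 0) and (0, 2).
  | (1, 0) | (0, 1) => quadSum 0 1 0 2 + zVar * qVar ^ 2 * quadSum 1 2 2 4
  | _ => quadSum 1 1 2 2

theorem levelTwoSum_eq_sum : ∀ i ∈ levelPairs 2, levelTwoSum i = ∑ j ∈ levelPairs 2,
    transfer 2 i j * PowerSeries.rescale (PowerSeries.X ^ 2) (levelTwoSum j) := by
  have hs : levelPairs 2 = {(0, 0), (1, 0), (0, 1), (2, 0), (1, 1), (0, 2)} := by decide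
  rw [hs]
  intro i hi
  simp only [Finset.mem_insert, Finset.mem_singleton] at hi
  rcases hi with rfl | rfl | rfl | rfl | rfl | rfl <;>
    simp [transfer, levelTwoSum, Finset.sum_range_succ, rescale_quadSum, rescale_zVar, rescale_qVar]
  · linear_combination isContiguous_quadSum.eq_zero_zero
  · linear_combination isContiguous_quadSum.eq_one_zero
  · linear_combination isContiguous_quadSum.eq_one_zero
  · linear_combination isContiguous_quadSum.eq_two_zero
  · linear_combination isContiguous_quadSum.eq_one_one
  · linear_combination isContiguous_quadSum.eq_two_zero

theorem levelGenFun_two_eq {i : ℕ × ℕ} (hi : i ∈ levelPairs 2) :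
    levelGenFun 2 i = levelTwoSum i :=
  eq_of_eq_sum_rescale (i₀ := 0) (mem_levelPairs.2 (Nat.zero_le _))
    (fun _ hi _ _ => constantCoeff_transfer hi)
    ((constantCoeff_levelGenFun 2).trans (constantCoeff_quadSum 0 0 0 0).symm)
    (fun _ hi => levelGenFun_eq_sum hi) levelTwoSum_eq_sum i hi

/-- The extra power q^{r₁+r₂+2s₁+2s₂} raises the linear exponents by (1, 1, 2, 2), so the factor 1 +
zq^{2+⋯} splits the series into two quadruple sums. -/
theorem hasSum_quadTerm_add (a₁ a₂ b₁ b₂ : ℕ) :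
    HasSum (fun x => quadTerm a₁ a₂ b₁ b₂ x *
        (1 + zVar * qVar ^ (2 + ((x.1 + 2 * x.2.2.1) + (x.2.1 + 2 * x.2.2.2)))))
      (quadSum a₁ a₂ b₁ b₂ +
        zVar * qVar ^ 2 * quadSum (a₁ + 1) (a₂ + 1) (b₁ + 2) (b₂ + 2)) := by
  refine ((hasSum_quadSum _ _ _ _).add ((hasSum_quadSum _ _ _ _).mul_left _)).congr_fun fun x => ?_
  simp only [quadTerm, quadCoeff, qVar, map_mul, map_pow]
  ring

/-- The four multisum formulas for `𝒟^{(2)}_Λ(z, q)`, with `Λ` equal to `2Λ_0`, `2Λ_1`, `Λ_0 + Λ_1`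
and `Λ_0 + Λ_2`. Each sum over `r₁, r₂, s₁, s₂ ≥ 0` converges coefficientwise, and
`r₃ = s₀ = 0`. -/
theorem mainTheorem4 :
    HasSum (fun ((r₁, r₂, s₁, s₂) : ℕ × ℕ × ℕ × ℕ) =>
        multisumFactor r₁ s₁ (r₁ + 2 * s₁) ((r₁ : ℤ) - r₂) ((s₁ : ℤ) - 0) *
          multisumFactor r₂ s₂ (r₂ + 2 * s₂) ((r₂ : ℤ) - 0) ((s₂ : ℤ) - s₁))
      (dGenFun 2 ![2, 0, 0]) ∧
    HasSum (fun ((r₁, r₂, s₁, s₂) : ℕ × ℕ × ℕ × ℕ) =>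
        multisumFactor r₁ s₁ 0 ((r₁ : ℤ) - r₂) ((s₁ : ℤ) - 0) *
          multisumFactor r₂ s₂ 0 ((r₂ : ℤ) - 0) ((s₂ : ℤ) - s₁))
      (dGenFun 2 ![0, 2, 0]) ∧
    HasSum (fun ((r₁, r₂, s₁, s₂) : ℕ × ℕ × ℕ × ℕ) =>
        multisumFactor r₁ s₁ 0 ((r₁ : ℤ) - r₂) ((s₁ : ℤ) - 0) *
          multisumFactor r₂ s₂ (r₂ + 2 * s₂) ((r₂ : ℤ) - 0) ((s₂ : ℤ) - s₁) *
          (1 + zVar * qVar ^ (2 + ((r₁ + 2 * s₁) + (r₂ + 2 * s₂)))))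
      (dGenFun 2 ![1, 1, 0]) ∧
    HasSum (fun ((r₁, r₂, s₁, s₂) : ℕ × ℕ × ℕ × ℕ) =>
        multisumFactor r₁ s₁ r₁ ((r₁ : ℤ) - r₂) ((s₁ : ℤ) - 0) *
          multisumFactor r₂ s₂ (r₂ + 2 * s₂) ((r₂ : ℤ) - 0) ((s₂ : ℤ) - s₁) *
          (1 + zVar * qVar ^ (2 + ((r₁ + 2 * s₁) + (r₂ + 2 * s₂)))))
      (dGenFun 2 ![1, 0, 1]) := by
  refine ⟨?_, ?_, ?_, ?_⟩
  -- The boundary pair is (k₀, k₂); the middle entry is k₁ = 2 - k₀ - k₂.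
  · rw [show dGenFun 2 ![2, 0, 0] = quadSum 1 1 2 2 from
      levelGenFun_two_eq (i := (2, 0)) (by decide)]
    exact (hasSum_quadSum 1 1 2 2).congr_fun fun ⟨r₁, r₂, s₁, s₂⟩ =>
      multisumFactor_mul _ _ _ _ _ _ _ _ _ _ (by ring)
  · rw [show dGenFun 2 ![0, 2, 0] = quadSum 0 0 0 0 from
      levelGenFun_two_eq (i := (0, 0)) (by decide)]
    exact (hasSum_quadSum 0 0 0 0).congr_fun fun ⟨r₁, r₂, s₁, s₂⟩ =>
      multisumFactor_mul _ _ _ _ _ _ _ _ _ _ (by ring)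
  · rw [show dGenFun 2 ![1, 1, 0] = quadSum 0 1 0 2 + zVar * qVar ^ 2 * quadSum 1 2 2 4 from
      levelGenFun_two_eq (i := (1, 0)) (by decide)]
    exact (hasSum_quadTerm_add 0 1 0 2).congr_fun fun ⟨r₁, r₂, s₁, s₂⟩ =>
      congrArg (· * _) (multisumFactor_mul _ _ _ _ _ _ _ _ _ _ (by ring))
  · rw [show dGenFun 2 ![1, 0, 1] = quadSum 1 1 0 2 + zVar * qVar ^ 2 * quadSum 2 2 2 4 from
      levelGenFun_two_eq (i := (1, 1)) (by decide)]
    exact (hasSum_quadTerm_add 1 1 0 2).congr_fun fun ⟨r₁, r₂, s₁, s₂⟩ =>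
      congrArg (· * _) (multisumFactor_mul _ _ _ _ _ _ _ _ _ _ (by ring))
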